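/- Let $n\ge 1$ and consider a deck of $n$ cards labelled $1,\dots,n$ from top to bottom. The deck is riffle shuffled once according to the Gilbert--Shannon--Reeds model: it is cut so that the first packet consists of the cards $1,\dots,k$ with probability $\binom{n}{k}/2^n$, $0\le k\le n$, and the second packet consists of the cards $k+1,\dots,n$. The two packets are then interleaved, one card at a time being moved from the bottom of one of the packets to the top of the new pile: when $m_1$ cards remain in the first packet and $m_2$ in the second one, the card is taken from the first packet with probability $m_1/(m_1+m_2)$ and from the second one with probability $m_2/(m_1+m_2)$. Without any feedback, the cards of the shuffled deck are guessed from top to bottom according to the following strategy. The top half of the deck (positions $1\le j\le \lceil n/2\rceil$) is guessed with the sequence $1,2,2,3,3,4,4,\dots$, i.e. the guess for position $j$ is $\lfloor j/2\rfloor+1$. The bottom half (positions $\lceil n/2\rceil<j\le n$) is guessed with the sequence $\dots,n-2,n-2,n-1,n-1,n$, i.e. the guess for position $j$ is $n-\lfloor (n+1-j)/2\rfloor$. Let $X_n$ denote the number of correct guesses. Let $H_1,H_2$ be independent random variables, each with the half-normal density $\frac{2}{\sqrt{\pi}}e^{-x^2}$ on $x\ge 0$. Then, for every fixed integer $s\ge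 0$, the $s$-th moments converge as $n\to\infty$: $$\mathbb{E}\Big(\Big(\frac{X_n}{\sqrt n}\Big)^s\Big)\to \tilde\mu_s=\mathbb{E}\big((H_1+H_2)^s\big)=\sum_{k=0}^{s}\binom{s}{k}\frac{\Gamma\big(\frac{k+1}{2}\big)\,\Gamma\big(\frac{s-k+1}{2}\big)}{\pi}.$$ More precisely, $$\mathbb{E}(X_n^s)=\tilde\mu_s\, n^{s/2}\big(1+\mathcal{O}(n^{-1/2})\big)\qquad (n\to\infty),$$ where the constant in the $\mathcal{O}$-term may depend on $s$. -/

import Mathlib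

open MeasureTheory ProbabilityTheory Filter Topology Asymptotics
open scoped ENNReal

namespace RiffleGuessing

/-- The cut of a deck of `n` cards: the first packet receives `k` cards, `0 ≤ k ≤ n`,
with probability `(n choose k) / 2 ^ n`. -/
noncomputable def cut (n : ℕ) : PMF (Fin (n + 1)) :=
  PMF.ofFintype (fun k => (n.choose (k : ℕ) : ℝ≥0∞) / 2 ^ n) (by
    have h : ∑ k : Fin (n + 1), (n.choose (k : ℕ) : ℝ≥0∞) = 2 ^ n := by
      rw [Fin.sum_univ_eq_sum_range (fun k => (n.choose k : ℝ≥0∞)) (n + 1)]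
      exact_mod_cast Nat.sum_range_choose n
    simp only [div_eq_mul_inv]
    rw [← Finset.sum_mul, h]
    exact ENNReal.mul_inv_cancel (by simp) (by simp))

/-- The packet from which the next card is dropped, when `m₁` and `m₂` cards remain in the first
and the second packet: the first packet (`true`) has probability `m₁ / (m₁ + m₂)`, the second
one (`false`) has probability `m₂ / (m₁ + m₂)`. -/
noncomputable def nextPacket (m₁ m₂ : ℕ) (h : m₁ + m₂ ≠ 0) : PMF Bool :=
  PMF.ofFintype
    (fun b => (if b then (m₁ : ℝ≥0∞) else (m₂ : ℝ≥0∞)) / ((m₁ + m₂ : ℕ) : ℝ≥0∞)) (by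
    rw [Fintype.sum_bool]
    simp only [div_eq_mul_inv, if_true, Bool.false_eq_true, if_false]
    rw [← add_mul, ← Nat.cast_add]
    exact ENNReal.mul_inv_cancel (by exact_mod_cast h) (by simp))

/-- Interleaving after a cut at `k`, with `m₁` cards left in the first packet (the cards
`1, …, m₁`, from top to bottom) and `m₂` cards left in the second packet (the cards
`k + 1, …, k + m₂`, from top to bottom). The bottom card of the chosen packet is dropped onto the
new pile, and the cards dropped later come to lie above it. Decks are listed from top to bottom. -/
noncomputable def interleave (k : ℕ) : ℕ → ℕ → PMF (List ℕ)
  | 0, 0 => PMF.pure []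
  | m₁ + 1, 0 => (interleave k m₁ 0).map (fun l => l ++ [m₁ + 1])
  | 0, m₂ + 1 => (interleave k 0 m₂).map (fun l => l ++ [k + (m₂ + 1)])
  | m₁ + 1, m₂ + 1 =>
    (nextPacket (m₁ + 1) (m₂ + 1) (by omega)).bind fun b =>
      if b then (interleave k m₁ (m₂ + 1)).map (fun l => l ++ [m₁ + 1])
      else (interleave k (m₁ + 1) m₂).map (fun l => l ++ [k + (m₂ + 1)])

/-- The deck (listed from top to bottom) after one Gilbert–Shannon–Reeds riffle shuffle of the
sorted deck `1, 2, …, n`. -/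
noncomputable def riffleShuffle (n : ℕ) : PMF (List ℕ) :=
  (cut n).bind fun k => interleave k k (n - k)

/-- The guess for the card at position `j`, `1 ≤ j ≤ n` (position `1` is the top of the deck).
The top half, positions `1 ≤ j ≤ ⌈n / 2⌉`, is guessed with `1, 2, 2, 3, 3, 4, 4, …`, and the
bottom half with `…, n - 2, n - 2, n - 1, n - 1, n`. -/
def guess (n j : ℕ) : ℕ :=
  if j ≤ (n + 1) / 2 then j / 2 + 1 else n - (n + 1 - j) / 2

/-- The number of positions `1 ≤ j ≤ n` at which the guess agrees with the card of the deck. -/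
def correctGuesses (n : ℕ) (deck : List ℕ) : ℕ :=
  ((Finset.Icc 1 n).filter fun j => deck[j - 1]? = some (guess n j)).card

/-- The law of the number of correct guesses after a single riffle shuffle of `n` cards. -/
noncomputable def correctGuessesLaw (n : ℕ) : Measure ℕ :=
  ((riffleShuffle n).map (correctGuesses n)).toMeasure

/-- The half-normal law with density `(2 / √π) exp (-x ^ 2)` on `[0, ∞)`. -/
noncomputable def halfNormalLaw : Measure ℝ :=
  volume.withDensity fun x =>
    ENNReal.ofReal (if 0 ≤ x then 2 / √Real.pi * Real.exp (-x ^ 2) else 0)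

/-- The number `∑ₖ (s choose k) Γ((k + 1) / 2) Γ((s - k + 1) / 2) / π`. -/
noncomputable def limitMoment (s : ℕ) : ℝ :=
  ∑ k ∈ Finset.range (s + 1),
    (s.choose k : ℝ) *
      (Real.Gamma (((k : ℝ) + 1) / 2) * Real.Gamma (((s : ℝ) - (k : ℝ) + 1) / 2) / Real.pi)

end RiffleGuessing

/-!
A riffle shuffle is driven by a uniformly distributed word of `n` letters: the letter at position
`j`, from the top, tells which packet the card there comes from, and the first packet has as many
cards as there are letters `true` (`expect_riffleShuffle`; all interleavings of two packets are
equally likely). Read the letters as the steps `±1` of a simple random walk. A card of the first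
packet at position `j` of the top half is guessed correctly exactly when the walk steps upwards at
time `j` out of `0` or `1`. Read upwards and with the packets exchanged, the bottom half behaves in
the same way. The other packet contributes only if the cut is far from the middle,
which has exponentially small probability. So, up to a negligible event, the number of
correct guesses is a sum of two independent variables, the numbers of rising steps out of `0` and
`1` of walks with `⌈n / 2⌉` and `⌊n / 2⌋` steps (`correctGuesses_eq_upSteps`,
`abs_guessMoment_sub_le`).

The number of these rising steps differs by at most `1` from the number `V` of visits of the walk
to `1` (`upSteps_add_eq`). The rising factorial moments of `V` are known exactly:
a renewal argument (`visitMoment_succ_left`) expresses the mean of `(V + r + 1).choose (r + 1)`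
through that of `(V + r).choose r` by a convolution with the return probabilities
`centralBinom i / 4 ^ i`, the coefficients of `(1 - z) ^ (-1 / 2)`, so that the mean of
`(V + r).choose r` is the
coefficient of `z ^ N` in `(1 - z) ^ (-(1 + r / 2))` for some `N` close to `n / 4`
(`visitMoment_origin`).
The log-convexity of the Gamma function gives the size of these coefficients up to a
relative error `O(1 / n)`. Passing from rising factorials to powers costs a relative error
`O(n ^ (-1 / 2))` (`rootRate_upSteps`). The limits are the moments of the half-normal law, and the
binomial theorem combines the two independent halves (`rootRate_upStepsMoment`).
-/

namespace RiffleGuessing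

/-! ### Sums over coin-toss words -/

/-- The sum of `f` over all words of length `n` in the letters `true` and `false`. -/
def coinSum {M : Type*} [AddCommMonoid M] : ℕ → (List Bool → M) → M
  | 0, f => f []
  | n + 1, f => coinSum n (fun w => f (true :: w)) + coinSum n (fun w => f (false :: w))

section CoinSum

variable {M : Type*} [AddCommMonoid M]

theorem coinSum_congr {n : ℕ} {f g : List Bool → M} (h : ∀ w, w.length = n → f w = g w) :
    coinSum n f = coinSum n g := by
  induction n generalizing f g with
  | zero => exact h [] rfl
  | succ n ih =>
    simp only [coinSum]
    rw [ih fun w hw => h (true :: w) (by simp [hw]), ih fun w hw => h (false :: w) (by simp [hw])]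

theorem coinSum_add (n : ℕ) (f g : List Bool → M) :
    coinSum n (fun w => f w + g w) = coinSum n f + coinSum n g := by
  induction n generalizing f g with
  | zero => rfl
  | succ n ih =>
    simp only [coinSum]
    rw [ih, ih, add_add_add_comm]

theorem map_coinSum {N : Type*} [AddCommMonoid N] (φ : M →+ N) (n : ℕ) (f : List Bool → M) :
    φ (coinSum n f) = coinSum n fun w => φ (f w) := by
  induction n generalizing f with
  | zero => rfl
  | succ n ih => simp only [coinSum, map_add, ih]

theorem coinSum_mul_left {R : Type*} [Semiring R] (n : ℕ) (c : R) (f : List Bool → R) :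
    coinSum n (fun w => c * f w) = c * coinSum n f :=
  (map_coinSum (AddMonoidHom.mulLeft c) n f).symm

theorem coinSum_mul_right {R : Type*} [Semiring R] (n : ℕ) (c : R) (f : List Bool → R) :
    coinSum n (fun w => f w * c) = coinSum n f * c :=
  (map_coinSum (AddMonoidHom.mulRight c) n f).symm

theorem coinSum_finset_sum {ι : Type*} (s : Finset ι) (n : ℕ) (f : ι → List Bool → M) :
    coinSum n (fun w => ∑ i ∈ s, f i w) = ∑ i ∈ s, coinSum n (f i) := by
  induction n generalizing f with
  | zero => rfl
  | succ n ih => simp only [coinSum, ih, Finset.sum_add_distrib]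

theorem natCast_coinSum {R : Type*} [Semiring R] (n : ℕ) (f : List Bool → ℕ) :
    ((coinSum n f : ℕ) : R) = coinSum n fun w => (f w : R) :=
  map_coinSum (Nat.castAddMonoidHom R) n f

theorem coinSum_append (m n : ℕ) (f : List Bool → M) :
    coinSum (m + n) f = coinSum m fun u => coinSum n fun v => f (u ++ v) := by
  induction m generalizing f with
  | zero => simp [coinSum]
  | succ m ih =>
    rw [Nat.add_right_comm]
    simp only [coinSum, ih, List.cons_append]

theorem coinSum_concat (n : ℕ) (f : List Bool → M) :
    coinSum (n + 1) f =
      coinSum n (fun w => f (w ++ [true])) + coinSum n fun w => f (w ++ [false]) := by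
  rw [coinSum_append, ← coinSum_add]
  rfl

theorem coinSum_map_not (n : ℕ) (f : List Bool → M) :
    coinSum n (fun w => f (w.map not)) = coinSum n f := by
  induction n generalizing f with
  | zero => rfl
  | succ n ih =>
    simp only [coinSum, List.map_cons, Bool.not_true, Bool.not_false]
    rw [ih fun w => f (false :: w), ih fun w => f (true :: w), add_comm]

theorem coinSum_reverse (n : ℕ) (f : List Bool → M) :
    coinSum n (fun w => f w.reverse) = coinSum n f := by
  induction n generalizing f with
  | zero => rfl
  | succ n ih =>
    rw [coinSum_concat]
    simp only [List.reverse_append, List.reverse_cons, List.reverse_nil, List.nil_append,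
      List.cons_append]
    rw [ih fun w => f (true :: w), ih fun w => f (false :: w)]
    rfl

theorem coinSum_reverse_map_not (n : ℕ) (f : List Bool → M) :
    coinSum n (fun w => f (w.map not).reverse) = coinSum n f := by
  rw [coinSum_map_not n fun w => f w.reverse, coinSum_reverse]

theorem coinSum_mono {R : Type*} [AddCommMonoid R] [PartialOrder R] [IsOrderedAddMonoid R] {n : ℕ}
    {f g : List Bool → R} (h : ∀ w, w.length = n → f w ≤ g w) : coinSum n f ≤ coinSum n g := by
  induction n generalizing f g with
  | zero => exact h [] rfl
  | succ n ih =>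
    exact add_le_add (ih fun w hw => h (true :: w) (by simp [hw]))
      (ih fun w hw => h (false :: w) (by simp [hw]))

theorem coinSum_zero (n : ℕ) : coinSum n (fun _ => (0 : M)) = 0 := by
  induction n with
  | zero => rfl
  | succ n ih => simp [coinSum, ih]

theorem coinSum_eq_zero {n : ℕ} {f : List Bool → M} (h : ∀ w, w.length = n → f w = 0) :
    coinSum n f = 0 :=
  (coinSum_congr h).trans (coinSum_zero n)

theorem coinSum_one {R : Type*} [Semiring R] (n : ℕ) : coinSum n (fun _ => (1 : R)) = 2 ^ n := by
  induction n with
  | zero => simp [coinSum]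
  | succ n ih => simp only [coinSum, ih]; rw [pow_succ, mul_two]

end CoinSum

/-! ### Visits of the simple random walk to the origin -/

/-- The step `1` or `-1` of the walk that a letter encodes. -/
def step (b : Bool) : ℤ := if b then 1 else -1

/-- The displacement of the walk whose steps are the letters of `w`. -/
def displacement (w : List Bool) : ℤ := (w.map step).sum

/-- The number of visits to `0` of the walk with steps `w` started at `x`; the initial position
does not count as a visit. -/
def visits : ℤ → List Bool → ℕ
  | _, [] => 0
  | x, b :: w => (if x + step b = 0 then 1 else 0) + visits (x + step b) w

/-- The number of words of length `j` that lead the walk from `x` to `0`. -/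
def pathCount (j : ℕ) (x : ℤ) : ℕ := coinSum j fun w => if x + displacement w = 0 then 1 else 0

/-- The unnormalized rising factorial moment of the number of visits, started at `x`. -/
def visitMoment (r m : ℕ) (x : ℤ) : ℕ := coinSum m fun w => (visits x w + r).choose r

theorem pathCount_zero (x : ℤ) : pathCount 0 x = if x = 0 then 1 else 0 := by
  simp [pathCount, coinSum, displacement]

theorem pathCount_succ (j : ℕ) (x : ℤ) :
    pathCount (j + 1) x = pathCount j (x + 1) + pathCount j (x - 1) := by
  simp only [pathCount, coinSum, displacement, List.map_cons, List.sum_cons, step, if_true,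
    ← add_assoc, Bool.false_eq_true, if_false, ← sub_eq_add_neg]
  rfl

theorem displacement_eq (w : List Bool) :
    displacement w = (w.count true : ℤ) - w.count false := by
  induction w with
  | nil => rfl
  | cons b w ih =>
    have h : displacement (b :: w) = step b + displacement w := by simp [displacement]
    rw [h, ih]
    cases b <;> simp [step] <;> ring

theorem coinSum_count_eq (n i : ℕ) :
    coinSum n (fun w => if w.count true = i then 1 else 0) = n.choose i := by
  induction n generalizing i with
  | zero => cases i <;> simp [coinSum]
  | succ n ih =>
    cases i with
    | zero => simpa [coinSum, coinSum_zero] using ih 0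
    | succ i => simp [coinSum, ih, Nat.choose_succ_succ]

theorem pathCount_two_mul (i : ℕ) : pathCount (2 * i) 0 = i.centralBinom := by
  rw [Nat.centralBinom, ← coinSum_count_eq]
  refine coinSum_congr fun w hw => ?_
  have h := w.count_true_add_count_false
  rw [displacement_eq]
  congr 1
  simp only [eq_iff_iff]
  omega

theorem pathCount_two_mul_add_one (i : ℕ) : pathCount (2 * i + 1) 0 = 0 := by
  refine coinSum_eq_zero fun w hw => if_neg ?_
  have h := w.count_true_add_count_false
  rw [displacement_eq]
  omega

theorem visitMoment_zero (m : ℕ) (x : ℤ) : visitMoment 0 m x = 2 ^ m := by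
  simp [visitMoment, coinSum_one]

/-- A first step onto `0` raises the binomial coefficient by the neighbour in Pascal's triangle. -/
theorem coinSum_visits_step (r m : ℕ) (y : ℤ) :
    coinSum m (fun w => ((if y = 0 then 1 else 0) + visits y w + (r + 1)).choose (r + 1)) =
      visitMoment (r + 1) m y + if y = 0 then
        coinSum m fun w => ((if y = 0 then 1 else 0) + visits y w + r).choose r else 0 := by
  split_ifs with h
  · rw [visitMoment, ← coinSum_add]
    refine coinSum_congr fun w _ => ?_
    rw [show 1 + visits y w + (r + 1) = (visits y w + (r + 1)) + 1 by ring, Nat.choose_succ_succ,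
      show 1 + visits y w + r = visits y w + (r + 1) by ring]
    simp only [Nat.succ_eq_add_one]
    ring
  · simp [visitMoment]

theorem visitMoment_succ_right (r m : ℕ) (x : ℤ) :
    visitMoment r (m + 1) x =
      coinSum m (fun w => ((if x + 1 = 0 then 1 else 0) + visits (x + 1) w + r).choose r) +
      coinSum m (fun w => ((if x - 1 = 0 then 1 else 0) + visits (x - 1) w + r).choose r) := by
  simp only [visitMoment, coinSum, visits, step, if_true, Bool.false_eq_true, if_false,
    ← sub_eq_add_neg]

/-- Renewal identity. By the hockey-stick identity `(V + r + 1).choose (r + 1)` is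
`(V + r).choose r` plus the sum, over the visits to `0`, of `(V' + r).choose r`, with `V'` the
number of visits that are still to come; after a visit the walk starts afresh from `0`. -/
theorem visitMoment_succ_left (r m : ℕ) (x : ℤ) :
    visitMoment (r + 1) m x =
      visitMoment r m x +
        ∑ j ∈ Finset.range m, pathCount (j + 1) x * visitMoment r (m - (j + 1)) 0 := by
  induction m generalizing x with
  | zero => simp [visitMoment, coinSum, visits]
  | succ m ih =>
    -- the contribution of one of the two possible first steps, to `y`
    have key : ∀ y : ℤ,
        coinSum m (fun w => ((if y = 0 then 1 else 0) + visits y w + (r + 1)).choose (r + 1)) =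
          coinSum m (fun w => ((if y = 0 then 1 else 0) + visits y w + r).choose r) +
          ∑ j ∈ Finset.range (m + 1), pathCount j y * visitMoment r (m - j) 0 := by
      intro y
      rw [coinSum_visits_step, ih, Finset.sum_range_succ', pathCount_zero]
      split_ifs with h
      · subst h
        simp
        ring
      · simp [visitMoment]
    rw [visitMoment_succ_right, visitMoment_succ_right r, key, key]
    simp only [pathCount_succ _ x, add_mul, Finset.sum_add_distrib, Nat.add_sub_add_right]
    ring

theorem visits_neg (x : ℤ) (w : List Bool) : visits (-x) (w.map not) = visits x w := by
  induction w generalizing x with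
  | nil => rfl
  | cons b w ih =>
    have h : -x + step (!b) = -(x + step b) := by cases b <;> simp [step] <;> ring
    simp only [List.map_cons, visits, h, ih, neg_eq_zero]

theorem visitMoment_neg (r m : ℕ) (x : ℤ) : visitMoment r m (-x) = visitMoment r m x := by
  rw [visitMoment, ← coinSum_map_not]
  simp only [visits_neg]
  rfl

theorem visitMoment_succ_zero (r m : ℕ) :
    visitMoment r (m + 1) 0 = 2 * visitMoment r m (-1) := by
  have h := visitMoment_neg r m 1
  rw [visitMoment_succ_right]
  simp only [visitMoment] at h ⊢
  simp
  omega

/-- The coefficient of `z ^ N` in `(1 - z) ^ (-a)`. -/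
noncomputable def negBinomCoeff (a : ℝ) (N : ℕ) : ℝ :=
  (ascPochhammer ℝ N).eval a / N.factorial

theorem negBinomCoeff_zero (a : ℝ) : negBinomCoeff a 0 = 1 := by simp [negBinomCoeff]

theorem negBinomCoeff_succ (a : ℝ) (N : ℕ) :
    ((N : ℝ) + 1) * negBinomCoeff a (N + 1) = (a + N) * negBinomCoeff a N := by
  have h : (N.factorial : ℝ) ≠ 0 := by positivity
  have h' : (N : ℝ) + 1 ≠ 0 := by positivity
  rw [negBinomCoeff, negBinomCoeff, ascPochhammer_succ_eval, Nat.factorial_succ]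
  push_cast
  field_simp

/-- Chu–Vandermonde: `(1 - z) ^ (-a) * (1 - z) ^ (-b) = (1 - z) ^ (-(a + b))`. -/
theorem sum_antidiagonal_negBinomCoeff (a b : ℝ) (N : ℕ) :
    ∑ p ∈ Finset.HasAntidiagonal.antidiagonal N, negBinomCoeff a p.1 * negBinomCoeff b p.2 =
      negBinomCoeff (a + b) N := by
  induction N with
  | zero => simp [negBinomCoeff_zero]
  | succ N ih =>
    have h' : (N : ℝ) + 1 ≠ 0 := by positivity
    apply mul_left_cancel₀ h'
    rw [negBinomCoeff_succ, ← ih, Finset.mul_sum, Finset.mul_sum]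
    -- Split the factor `N + 1 = p.1 + p.2` and shift each of the two sums.
    have h1 : ∑ p ∈ Finset.HasAntidiagonal.antidiagonal (N + 1),
          ((N : ℝ) + 1) * (negBinomCoeff a p.1 * negBinomCoeff b p.2) =
        ∑ p ∈ Finset.HasAntidiagonal.antidiagonal (N + 1),
          (p.1 : ℝ) * negBinomCoeff a p.1 * negBinomCoeff b p.2 +
        ∑ p ∈ Finset.HasAntidiagonal.antidiagonal (N + 1),
          negBinomCoeff a p.1 * ((p.2 : ℝ) * negBinomCoeff b p.2) := by
      rw [← Finset.sum_add_distrib]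
      refine Finset.sum_congr rfl fun p hp => ?_
      have : ((p.1 : ℝ) + p.2) = N + 1 := by
        exact_mod_cast Finset.HasAntidiagonal.mem_antidiagonal.1 hp
      rw [← this]
      ring
    rw [h1, Finset.Nat.sum_antidiagonal_succ, Finset.Nat.sum_antidiagonal_succ']
    simp only [Nat.cast_zero, zero_mul, mul_zero, zero_add, Nat.cast_add, Nat.cast_one,
      negBinomCoeff_succ]
    rw [← Finset.sum_add_distrib]
    refine Finset.sum_congr rfl fun p hp => ?_
    have : ((p.1 : ℝ) + p.2) = N := by exact_mod_cast Finset.HasAntidiagonal.mem_antidiagonal.1 hp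
    rw [← this]
    ring

theorem negBinomCoeff_one (N : ℕ) : negBinomCoeff 1 N = 1 := by
  have h : (N.factorial : ℝ) ≠ 0 := by positivity
  rw [negBinomCoeff, ascPochhammer_eval_one, div_self h]

theorem negBinomCoeff_half (i : ℕ) :
    negBinomCoeff (1 / 2) i = (i.centralBinom : ℝ) / 4 ^ i := by
  induction i with
  | zero => simp [negBinomCoeff_zero]
  | succ i ih =>
    have h' : (i : ℝ) + 1 ≠ 0 := by positivity
    have h : ((i : ℝ) + 1) * (i + 1).centralBinom = 2 * (2 * i + 1) * i.centralBinom := by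
      exact_mod_cast Nat.succ_mul_centralBinom_succ i
    apply mul_left_cancel₀ h'
    rw [negBinomCoeff_succ, ih, ← mul_div_assoc, ← mul_div_assoc, h, pow_succ]
    field_simp
    ring

/-- The visits to the origin of a walk started there have the rising factorial moments
`[z ^ N] (1 - z) ^ (-(1 + r / 2))`, where `N = ⌊m / 2⌋`. -/
theorem visitMoment_origin (r m : ℕ) :
    (visitMoment r m 0 : ℝ) = 2 ^ m * negBinomCoeff (1 + r / 2) (m / 2) := by
  induction r generalizing m with
  | zero => simp [visitMoment_zero, negBinomCoeff_one]
  | succ r ih =>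
    have h0 : visitMoment (r + 1) m 0 =
        ∑ j ∈ Finset.range (m + 1), pathCount j 0 * visitMoment r (m - j) 0 := by
      rw [visitMoment_succ_left, Finset.sum_range_succ', pathCount_zero]
      simp
      ring
    -- only the even times contribute
    have h1 : ∑ j ∈ Finset.range (m + 1), pathCount j 0 * visitMoment r (m - j) 0 =
        ∑ i ∈ Finset.range (m / 2 + 1),
          pathCount (2 * i) 0 * visitMoment r (m - 2 * i) 0 := by
      rw [← Finset.sum_image (g := fun i => 2 * i)
        (f := fun j => pathCount j 0 * visitMoment r (m - j) 0) (fun a _ b _ h => by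
          simpa using h)]
      symm
      apply Finset.sum_subset
      · intro j hj
        simp only [Finset.mem_image, Finset.mem_range] at hj ⊢
        omega
      · intro j hj hj'
        simp only [Finset.mem_image, Finset.mem_range, not_exists, not_and] at hj hj'
        obtain ⟨i, rfl | rfl⟩ := j.even_or_odd'
        · exact absurd rfl (hj' i (by omega))
        · rw [pathCount_two_mul_add_one, zero_mul]
    have h2 : (1 + ((r + 1 : ℕ) : ℝ) / 2) = 1 / 2 + (1 + r / 2) := by push_cast; ring
    rw [h0, h1, h2, ← sum_antidiagonal_negBinomCoeff,
      Finset.Nat.sum_antidiagonal_eq_sum_range_succ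
        (fun i j => negBinomCoeff (1 / 2) i * negBinomCoeff (1 + r / 2) j), Finset.mul_sum]
    push_cast
    refine Finset.sum_congr rfl fun i hi => ?_
    have hi' : 2 * i ≤ m := by have := Finset.mem_range.1 hi; omega
    rw [pathCount_two_mul, ih, negBinomCoeff_half, show (m - 2 * i) / 2 = m / 2 - i by omega,
      pow_sub₀ _ two_ne_zero hi', pow_mul]
    norm_num
    ring

/-! ### Rising steps out of `0` and `1` -/

/-- The number of rising steps out of `0` or `1` of the walk with steps `w` started at `x`. -/
def upSteps : ℤ → List Bool → ℕ
  | _, [] => 0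
  | x, true :: w => (if x = 0 ∨ x = 1 then 1 else 0) + upSteps (x + 1) w
  | x, false :: w => upSteps (x - 1) w

/-- Each visit to `1` is entered and left through the edges `{0, 1}` and `{1, 2}`, and each of these
edges is crossed alternately upwards and downwards, so up to a boundary term the rising
steps out of `0` and `1` are as many as the visits to `1` (visits to `0` of the shifted walk). -/
theorem upSteps_add_eq (x : ℤ) (w : List Bool) :
    upSteps x w + (if 2 ≤ x then 1 else 0) =
      visits (x - 1) w + if 2 ≤ x + displacement w then 1 else 0 := by
  induction w generalizing x with
  | nil => simp [upSteps, visits, displacement]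
  | cons b w ih =>
    have h : x + displacement (b :: w) = x + step b + displacement w := by
      simp [displacement, add_assoc]
    have := ih (x + step b)
    rw [h]
    simp only [visits]
    rw [show x - 1 + step b = x + step b - 1 by ring]
    cases b <;> simp only [upSteps, step, if_true, Bool.false_eq_true, if_false,
      ← sub_eq_add_neg] at this ⊢ <;> split_ifs at this ⊢ <;> omega

theorem visits_le_upSteps (w : List Bool) : visits (-1) w ≤ upSteps 0 w := by
  have := upSteps_add_eq 0 w
  simp at this
  omega

theorem upSteps_le_visits_add_one (w : List Bool) : upSteps 0 w ≤ visits (-1) w + 1 := by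
  have := upSteps_add_eq 0 w
  simp at this
  split_ifs at this <;> omega

theorem upSteps_le_length (x : ℤ) (w : List Bool) : upSteps x w ≤ w.length := by
  induction w generalizing x with
  | nil => rfl
  | cons b w ih =>
    cases b
    · simpa [upSteps] using (ih (x - 1)).trans (Nat.le_succ _)
    · have := ih (x + 1)
      simp only [upSteps, List.length_cons]
      split_ifs <;> omega

theorem upSteps_concat (x : ℤ) (w : List Bool) (b : Bool) :
    upSteps x (w ++ [b]) = upSteps x w +
      if b = true ∧ (x + displacement w = 0 ∨ x + displacement w = 1) then 1 else 0 := by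
  induction w generalizing x with
  | nil => cases b <;> simp [upSteps, displacement]
  | cons c w ih =>
    have h : x + displacement (c :: w) = x + step c + displacement w := by
      simp [displacement, add_assoc]
    rw [h]
    cases c
    · simp only [List.cons_append, upSteps, ih, step, Bool.false_eq_true, if_false,
        ← sub_eq_add_neg]
    · simp only [List.cons_append, upSteps, ih, step, if_true]
      ring

/-! ### The shuffled deck as a function of a uniform word -/

/-- The expectation of `g` under the discrete law `p`. -/
noncomputable def expect {α : Type*} (p : PMF α) (g : α → ℝ≥0∞) : ℝ≥0∞ := ∑' a, p a * g a

theorem expect_pure {α : Type*} (a : α) (g : α → ℝ≥0∞) : expect (PMF.pure a) g = g a := by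
  rw [expect, tsum_eq_single a]
  · simp
  · intro b hb
    simp [hb]

theorem expect_bind {α β : Type*} (p : PMF α) (q : α → PMF β) (g : β → ℝ≥0∞) :
    expect (p.bind q) g = expect p fun a => expect (q a) g := by
  simp only [expect, PMF.bind_apply, ← ENNReal.tsum_mul_right, ← ENNReal.tsum_mul_left, mul_assoc]
  exact ENNReal.tsum_comm

theorem expect_map {α β : Type*} (p : PMF α) (f : α → β) (g : β → ℝ≥0∞) :
    expect (p.map f) g = expect p fun a => g (f a) := by
  rw [PMF.map, expect_bind]
  simp only [Function.comp_apply, expect_pure]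

/-- The deck that results from a word in which `true` stands for a card of the first packet and
`false` for a card of the second packet, both read from top to bottom. The first packet has `k`
cards, and `i` cards of the first and `z` cards of the second packet lie above the part of the deck
that is listed. -/
def deckOf (k : ℕ) : ℕ → ℕ → List Bool → List ℕ
  | _, _, [] => []
  | i, z, true :: w => (i + 1) :: deckOf k (i + 1) z w
  | i, z, false :: w => (k + (z + 1)) :: deckOf k i (z + 1) w

theorem deckOf_append (k i z : ℕ) (u v : List Bool) :
    deckOf k i z (u ++ v) =
      deckOf k i z u ++ deckOf k (i + u.count true) (z + u.count false) v := by
  induction u generalizing i z with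
  | nil => rfl
  | cons b u ih =>
    cases b <;> simp [deckOf, ih] <;> congr 1 <;> ring

theorem length_deckOf (k i z : ℕ) (w : List Bool) : (deckOf k i z w).length = w.length := by
  induction w generalizing i z with
  | nil => rfl
  | cons b w ih => cases b <;> simp [deckOf, ih]

/-- The sum of `g` over the decks that arise from the interleavings of `m₁` and `m₂` cards. -/
noncomputable def interleavingSum (k m₁ m₂ : ℕ) (g : List ℕ → ℝ≥0∞) : ℝ≥0∞ :=
  coinSum (m₁ + m₂) fun w => if w.count true = m₁ then g (deckOf k 0 0 w) else 0

theorem interleavingSum_succ_zero (k m₁ : ℕ) (g : List ℕ → ℝ≥0∞) :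
    interleavingSum k (m₁ + 1) 0 g = interleavingSum k m₁ 0 fun l => g (l ++ [m₁ + 1]) := by
  have h : coinSum m₁ (fun w => if (w ++ [false]).count true = m₁ + 1 then
      g (deckOf k 0 0 (w ++ [false])) else 0) = 0 := by
    refine coinSum_eq_zero fun w hw => if_neg ?_
    have := w.count_le_length (a := true)
    simp
    omega
  rw [interleavingSum, interleavingSum, add_zero, coinSum_concat, h, add_zero]
  refine coinSum_congr fun w hw => ?_
  simp only [List.count_append, List.count_singleton_self, add_left_inj, deckOf_append, zero_add]
  split_ifs with h
  · simp [deckOf, h]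
  · rfl

theorem interleavingSum_zero_succ (k m₂ : ℕ) (g : List ℕ → ℝ≥0∞) :
    interleavingSum k 0 (m₂ + 1) g =
      interleavingSum k 0 m₂ fun l => g (l ++ [k + (m₂ + 1)]) := by
  have h : coinSum m₂ (fun w => if (w ++ [true]).count true = 0 then
      g (deckOf k 0 0 (w ++ [true])) else 0) = 0 := by
    exact coinSum_eq_zero fun w hw => if_neg (by simp)
  rw [interleavingSum, interleavingSum, ← add_assoc, coinSum_concat, zero_add, h, zero_add]
  refine coinSum_congr fun w hw => ?_
  have h2 := w.count_true_add_count_false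
  simp only [List.count_append, deckOf_append, zero_add]
  rw [show List.count true [false] = 0 from rfl, add_zero]
  split_ifs with h
  · rw [show w.count false = m₂ by omega]
    simp [deckOf]
  · rfl

theorem interleavingSum_succ_succ (k m₁ m₂ : ℕ) (g : List ℕ → ℝ≥0∞) :
    interleavingSum k (m₁ + 1) (m₂ + 1) g =
      interleavingSum k m₁ (m₂ + 1) (fun l => g (l ++ [m₁ + 1])) +
      interleavingSum k (m₁ + 1) m₂ fun l => g (l ++ [k + (m₂ + 1)]) := by
  rw [interleavingSum, show m₁ + 1 + (m₂ + 1) = (m₁ + 1 + m₂) + 1 by ring, coinSum_concat,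
    interleavingSum, show m₁ + (m₂ + 1) = m₁ + 1 + m₂ by ring, interleavingSum]
  congr 1 <;> refine coinSum_congr fun w hw => ?_
  · simp only [List.count_append, List.count_singleton_self, add_left_inj, deckOf_append, zero_add]
    split_ifs with h
    · simp [deckOf, h]
    · rfl
  · have h2 := w.count_true_add_count_false
    simp only [List.count_append, deckOf_append, zero_add]
    rw [show List.count true [false] = 0 from rfl, add_zero]
    split_ifs with h
    · rw [show w.count false = m₂ by omega]
      simp [deckOf]
    · rfl

/-- All interleavings of two packets of `m₁` and `m₂` cards are equally likely. -/
theorem choose_mul_expect_interleave (k m₁ m₂ : ℕ) (g : List ℕ → ℝ≥0∞) :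
    ((m₁ + m₂).choose m₁ : ℝ≥0∞) * expect (interleave k m₁ m₂) g = interleavingSum k m₁ m₂ g := by
  induction m₁, m₂ using interleave.induct generalizing g with
  | case1 => simp [interleave, expect_pure, interleavingSum, coinSum, deckOf]
  | case2 m₁ ih =>
    rw [interleavingSum_succ_zero, ← ih, interleave, expect_map]
    simp
  | case3 m₂ ih =>
    rw [interleavingSum_zero_succ, ← ih, interleave, expect_map]
    simp
  | case4 m₁ m₂ ih1 ih2 =>
    rw [interleavingSum_succ_succ, ← ih1, ← ih2, interleave, expect_bind, expect,
      tsum_fintype, Fintype.sum_bool]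
    simp only [if_true, Bool.false_eq_true, if_false, expect_map, nextPacket,
      PMF.ofFintype_apply, mul_add, ← mul_assoc]
    -- `choose (a + b) a * a / (a + b) = choose (a + b - 1) (a - 1)` and its mirror image
    have hc : ∀ a b c d : ℕ, c ≠ 0 → a * b = d * c →
        (a : ℝ≥0∞) * ((b : ℝ≥0∞) / (c : ℝ≥0∞)) = d := by
      intro a b c d hc h
      rw [← mul_div_assoc, ← Nat.cast_mul, h, Nat.cast_mul]
      exact ENNReal.mul_div_cancel_right (by exact_mod_cast hc) (ENNReal.natCast_ne_top c)
    congr 2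
    · refine hc _ _ _ _ (by omega) ?_
      have := Nat.add_one_mul_choose_eq (m₁ + (m₂ + 1)) m₁
      rw [show m₁ + 1 + (m₂ + 1) = m₁ + (m₂ + 1) + 1 by ring]
      linarith
    · refine hc _ _ _ _ (by omega) ?_
      have := Nat.add_one_mul_choose_eq (m₁ + 1 + m₂) m₂
      rw [show m₁ + 1 + (m₂ + 1) = m₁ + 1 + m₂ + 1 by ring,
        ← Nat.choose_symm_of_eq_add (show m₁ + 1 + m₂ + 1 = m₂ + 1 + (m₁ + 1) by ring),
        ← Nat.choose_symm_of_eq_add (show m₁ + 1 + m₂ = m₂ + (m₁ + 1) by ring)]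
      linarith

/-- After one riffle shuffle the deck is a function of a uniformly distributed word. -/
theorem expect_riffleShuffle (n : ℕ) (g : List ℕ → ℝ≥0∞) :
    expect (riffleShuffle n) g =
      coinSum n (fun w => g (deckOf (w.count true) 0 0 w)) / 2 ^ n := by
  have h1 : ∀ k : Fin (n + 1), cut n k * expect (interleave k k (n - k)) g =
      interleavingSum k k (n - k) g / 2 ^ n := by
    intro k
    have hk : (k : ℕ) + (n - k) = n := by omega
    rw [← choose_mul_expect_interleave, hk, cut, PMF.ofFintype_apply]
    simp only [div_eq_mul_inv]
    ring
  rw [riffleShuffle, expect_bind, expect, tsum_fintype, Finset.sum_congr rfl fun k _ => h1 k]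
  simp only [div_eq_mul_inv]
  rw [← Finset.sum_mul]
  congr 1
  have h2 : ∀ k : Fin (n + 1), interleavingSum k k (n - k) g =
      coinSum n fun w => if w.count true = k then g (deckOf k 0 0 w) else 0 := by
    intro k
    rw [interleavingSum, show (k : ℕ) + (n - k) = n by omega]
  rw [Finset.sum_congr rfl fun k _ => h2 k, ← coinSum_finset_sum]
  refine coinSum_congr fun w hw => ?_
  have hc : w.count true < n + 1 := by
    have := w.count_le_length (a := true)
    omega
  rw [Finset.sum_eq_single ⟨w.count true, hc⟩]
  · simp
  · intro k _ hk
    refine if_neg fun h => hk ?_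
    ext
    exact h.symm
  · simp

/-! ### Correct guesses as rising steps of two walks -/

/-- The number of positions at which a list agrees with the sequence `g p, g (p + 1), …`. -/
def hits (g : ℕ → ℕ) : ℕ → List ℕ → ℕ
  | _, [] => 0
  | p, c :: l => (if c = g p then 1 else 0) + hits g (p + 1) l

theorem hits_append (g : ℕ → ℕ) (p : ℕ) (l l' : List ℕ) :
    hits g p (l ++ l') = hits g p l + hits g (p + l.length) l' := by
  induction l generalizing p with
  | nil => simp [hits]
  | cons c l ih =>
    simp only [List.cons_append, hits, ih, List.length_cons]
    rw [show p + 1 + l.length = p + (l.length + 1) by ring, add_assoc]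

theorem hits_eq_sum (g : ℕ → ℕ) (p : ℕ) (l : List ℕ) :
    hits g p l = ∑ i ∈ Finset.range l.length, if l[i]? = some (g (p + i)) then 1 else 0 := by
  induction l generalizing p with
  | nil => rfl
  | cons c l ih =>
    rw [List.length_cons, Finset.sum_range_succ', hits, ih, add_comm]
    simp [Nat.add_right_comm p, ← add_assoc]

theorem correctGuesses_eq_hits (l : List ℕ) :
    correctGuesses l.length l = hits (guess l.length) 1 l := by
  rw [correctGuesses, Finset.card_filter, hits_eq_sum, ← Finset.Ico_add_one_right_eq_Icc,
    Finset.sum_Ico_eq_sum_range]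
  simp

theorem correctGuesses_le (n : ℕ) (l : List ℕ) : correctGuesses n l ≤ n :=
  (Finset.card_filter_le _ _).trans (by simp)

/-- Unless the first packet is small, the correct guesses in the top half are the cards of the first
packet that were dropped when the walk stood at `0` or `1`. -/
theorem hits_guess_top (n k i z : ℕ) (u : List Bool) (hk : (n + 1) / 2 / 2 < k)
    (hu : i + z + u.length ≤ (n + 1) / 2) :
    hits (guess n) (i + z + 1) (deckOf k i z u) = upSteps ((i : ℤ) - z) u := by
  induction u generalizing i z with
  | nil => rfl
  | cons b u ih =>
    rw [List.length_cons] at hu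
    have hg : guess n (i + z + 1) = (i + z + 1) / 2 + 1 := if_pos (by omega)
    cases b
    · have h := ih i (z + 1) (by omega)
      rw [show ((i : ℤ) - (z + 1 : ℕ)) = i - z - 1 by push_cast; ring] at h
      rw [deckOf, hits, upSteps, hg, if_neg (by omega), zero_add, ← h]
      rfl
    · have h := ih (i + 1) z (by omega)
      rw [show (((i + 1 : ℕ) : ℤ) - z) = i - z + 1 by push_cast; ring,
        show i + 1 + z + 1 = i + z + 1 + 1 by ring] at h
      rw [deckOf, hits, upSteps, hg, h]
      congr 2
      simp only [eq_iff_iff]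
      omega

theorem displacement_reverse_map_not (w : List Bool) :
    displacement (w.map not).reverse = (w.count false : ℤ) - w.count true := by
  induction w with
  | nil => rfl
  | cons b w ih =>
    have h : displacement ((b :: w).map not).reverse =
        displacement (w.map not).reverse + step (!b) := by
      simp [displacement]
    rw [h, ih]
    cases b <;> simp [step] <;> ring

/-- Unless the second packet is small, the bottom half read upwards with the packets exchanged
behaves like the top half read downwards. -/
theorem hits_guess_bottom (n k i z : ℕ) (v : List Bool) (hn : i + z + v.length = n)
    (hv : (n + 1) / 2 ≤ i + z) (hk : i + v.count true = k) (hk' : k + n / 2 / 2 < n) :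
    hits (guess n) (i + z + 1) (deckOf k i z v) = upSteps 0 (v.map not).reverse := by
  induction v generalizing i z with
  | nil => rfl
  | cons b v ih =>
    have hc := v.count_true_add_count_false
    rw [List.length_cons] at hn
    have hg : guess n (i + z + 1) = n - (n + 1 - (i + z + 1)) / 2 := if_neg (by omega)
    rw [List.map_cons, List.reverse_cons, upSteps_concat, displacement_reverse_map_not]
    cases b
    · rw [List.count_cons_of_ne (by simp)] at hk
      have h := ih i (z + 1) (by omega) (by omega) hk
      rw [deckOf, hits, hg, ← h, add_comm]
      congr 2
      simp only [Bool.not_false, true_and, eq_iff_iff, zero_add]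
      omega
    · rw [List.count_cons_self] at hk
      have h := ih (i + 1) z (by omega) (by omega) (by omega)
      rw [show i + 1 + z + 1 = i + z + 1 + 1 by ring] at h
      rw [deckOf, hits, hg, ← h, if_neg (by omega), if_neg (by simp)]
      simp

theorem correctGuesses_eq_upSteps (n : ℕ) (u v : List Bool) (hu : u.length = (n + 1) / 2)
    (hv : v.length = n / 2) (h₁ : n / 4 + 2 < (u ++ v).count true)
    (h₂ : n / 4 + 2 < (u ++ v).count false) :
    correctGuesses n (deckOf ((u ++ v).count true) 0 0 (u ++ v)) =
      upSteps 0 u + upSteps 0 (v.map not).reverse := by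
  have hl : (deckOf ((u ++ v).count true) 0 0 (u ++ v)).length = n := by
    rw [length_deckOf, List.length_append]
    omega
  have hc := (u ++ v).count_true_add_count_false
  have hcu := u.count_true_add_count_false
  rw [List.length_append] at hc
  have h3 := correctGuesses_eq_hits (deckOf ((u ++ v).count true) 0 0 (u ++ v))
  rw [hl] at h3
  rw [h3, deckOf_append, hits_append, length_deckOf]
  have e1 := hits_guess_top n ((u ++ v).count true) 0 0 u (by omega) (by omega)
  have e2 := hits_guess_bottom n ((u ++ v).count true) (0 + u.count true) (0 + u.count false) v
    (by omega) (by omega) (by simp) (by omega)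
  rw [show 0 + u.count true + (0 + u.count false) + 1 = 1 + u.length by omega] at e2
  rw [e2]
  congr 1

/-! ### Moments of the number of rising steps -/

/-- The mean of `f` over the words of length `n`. -/
noncomputable def coinMean (n : ℕ) (f : List Bool → ℝ) : ℝ := coinSum n f / 2 ^ n

theorem coinMean_mono {n : ℕ} {f g : List Bool → ℝ} (h : ∀ w, w.length = n → f w ≤ g w) :
    coinMean n f ≤ coinMean n g :=
  div_le_div_of_nonneg_right (coinSum_mono h) (by positivity)

theorem coinMean_add (n : ℕ) (f g : List Bool → ℝ) :
    coinMean n (fun w => f w + g w) = coinMean n f + coinMean n g := by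
  rw [coinMean, coinSum_add, add_div, coinMean, coinMean]

theorem coinMean_mul_left (n : ℕ) (c : ℝ) (f : List Bool → ℝ) :
    coinMean n (fun w => c * f w) = c * coinMean n f := by
  rw [coinMean, coinSum_mul_left, mul_div_assoc, coinMean]

theorem coinMean_mul_right (n : ℕ) (c : ℝ) (f : List Bool → ℝ) :
    coinMean n (fun w => f w * c) = coinMean n f * c := by
  rw [coinMean, coinSum_mul_right, mul_div_right_comm, coinMean]

theorem coinMean_finset_sum {ι : Type*} (s : Finset ι) (n : ℕ) (f : ι → List Bool → ℝ) :
    coinMean n (fun w => ∑ i ∈ s, f i w) = ∑ i ∈ s, coinMean n (f i) := by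
  rw [coinMean, coinSum_finset_sum, Finset.sum_div]
  rfl

theorem coinMean_append (m n : ℕ) (f : List Bool → ℝ) :
    coinMean (m + n) f = coinMean m fun u => coinMean n fun v => f (u ++ v) := by
  simp only [coinMean, div_eq_mul_inv]
  rw [coinSum_append, coinSum_mul_right, pow_add, mul_inv]
  ring

theorem coinMean_reverse_map_not (n : ℕ) (f : List Bool → ℝ) :
    coinMean n (fun w => f (w.map not).reverse) = coinMean n f := by
  rw [coinMean, coinSum_reverse_map_not, coinMean]

theorem coinMean_ascFactorial_visits (r m : ℕ) :
    coinMean m (fun w => ((visits (-1) w + 1).ascFactorial r : ℝ)) =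
      r.factorial * negBinomCoeff (1 + r / 2) ((m + 1) / 2) := by
  have h1 : coinSum m (fun w => ((visits (-1) w + 1).ascFactorial r : ℝ)) =
      r.factorial * visitMoment r m (-1) := by
    rw [visitMoment, natCast_coinSum, ← coinSum_mul_left]
    refine coinSum_congr fun w _ => ?_
    rw [Nat.ascFactorial_eq_factorial_mul_choose]
    push_cast
    rfl
  have h2 : (2 : ℝ) * visitMoment r m (-1) =
      2 ^ (m + 1) * negBinomCoeff (1 + r / 2) ((m + 1) / 2) := by
    rw [← visitMoment_origin, visitMoment_succ_zero]
    push_cast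
    rfl
  have h3 : (visitMoment r m (-1) : ℝ) = 2 ^ m * negBinomCoeff (1 + r / 2) ((m + 1) / 2) := by
    rw [pow_succ] at h2
    linarith
  rw [coinMean, h1, h3]
  field_simp

theorem abs_pow_sub_ascFactorial_le {f v : ℕ} (h₁ : v ≤ f) (h₂ : f ≤ v + 1) (k : ℕ) :
    |(f : ℝ) ^ (k + 1) - (v + 1).ascFactorial (k + 1)| ≤
      ((k + 1 : ℕ) : ℝ) ^ (k + 2) * (v + 1).ascFactorial k := by
  have hup : ((v + 1).ascFactorial (k + 1) : ℝ) ≤ ((v : ℝ) + (k + 1 : ℕ)) ^ (k + 1) := by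
    exact_mod_cast (Nat.ascFactorial_le_pow_add v (k + 1))
  have hlow : (((v : ℝ) + 1) ^ (k + 1)) ≤ (v + 1).ascFactorial (k + 1) := by
    exact_mod_cast Nat.pow_succ_le_ascFactorial (v + 1) (k + 1)
  have hlow' : (((v : ℝ) + 1) ^ k) ≤ (v + 1).ascFactorial k := by
    exact_mod_cast Nat.pow_succ_le_ascFactorial (v + 1) k
  have hf : (f : ℝ) ^ (k + 1) ≤ ((v : ℝ) + 1) ^ (k + 1) := by
    gcongr
    exact_mod_cast h₂
  have hf' : (v : ℝ) ^ (k + 1) ≤ (f : ℝ) ^ (k + 1) := by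
    gcongr
  have hdiff : ((v : ℝ) + (k + 1 : ℕ)) ^ (k + 1) - (v : ℝ) ^ (k + 1) ≤
      ((k + 1 : ℕ) : ℝ) * ((k + 1 : ℕ) : ℝ) * ((v : ℝ) + (k + 1 : ℕ)) ^ k := by
    have h := abs_pow_sub_pow_le ((v : ℝ) + (k + 1 : ℕ)) v (k + 1)
    rw [abs_of_nonneg (sub_nonneg.2 (by gcongr; simp; positivity)), add_sub_cancel_left,
      abs_of_nonneg (by positivity), abs_of_nonneg (by positivity), abs_of_nonneg (by positivity),
      max_eq_left (by simp; positivity)] at h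
    simpa using h
  have hpow : ((v : ℝ) + (k + 1 : ℕ)) ^ k ≤ ((k + 1 : ℕ) : ℝ) ^ k * (v + 1).ascFactorial k := by
    refine le_trans ?_ (mul_le_mul_of_nonneg_left hlow' (by positivity))
    rw [← mul_pow]
    gcongr
    push_cast
    nlinarith [(Nat.cast_nonneg v : (0 : ℝ) ≤ v), (Nat.cast_nonneg k : (0 : ℝ) ≤ k),
      mul_nonneg (Nat.cast_nonneg v : (0 : ℝ) ≤ v) (Nat.cast_nonneg k : (0 : ℝ) ≤ k)]
  rw [abs_sub_comm, abs_of_nonneg (sub_nonneg.2 (hf.trans hlow))]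
  calc ((v + 1).ascFactorial (k + 1) : ℝ) - (f : ℝ) ^ (k + 1)
      ≤ ((v : ℝ) + (k + 1 : ℕ)) ^ (k + 1) - (v : ℝ) ^ (k + 1) := by linarith
    _ ≤ _ := hdiff
    _ ≤ ((k + 1 : ℕ) : ℝ) * ((k + 1 : ℕ) : ℝ) *
        (((k + 1 : ℕ) : ℝ) ^ k * (v + 1).ascFactorial k) := by gcongr
    _ = _ := by ring

theorem abs_coinMean_upSteps_sub_le (m k : ℕ) :
    |coinMean m (fun w => (upSteps 0 w : ℝ) ^ (k + 1)) -
        coinMean m (fun w => ((visits (-1) w + 1).ascFactorial (k + 1) : ℝ))| ≤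
      ((k + 1 : ℕ) : ℝ) ^ (k + 2) *
        coinMean m fun w => ((visits (-1) w + 1).ascFactorial k : ℝ) := by
  have h := fun w => abs_le.1 (abs_pow_sub_ascFactorial_le (visits_le_upSteps w)
    (upSteps_le_visits_add_one w) k)
  rw [← coinMean_mul_left, abs_le]
  constructor
  · rw [neg_le_sub_iff_le_add, ← coinMean_add]
    exact coinMean_mono fun w _ => by linarith [(h w).1]
  · rw [sub_le_iff_le_add, ← coinMean_add]
    exact coinMean_mono fun w _ => by linarith [(h w).2]

/-! ### Convergence at rate `n ^ (-1 / 2)` -/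

/-- The sequence `a` converges to `d` with error `O(n ^ (-1 / 2))`. -/
def RootRate (a : ℕ → ℝ) (d : ℝ) : Prop :=
  (fun n => a n - d) =O[atTop] fun n : ℕ => (√(n : ℝ))⁻¹

theorem inv_sqrt_isBigO_one : (fun n : ℕ => (√(n : ℝ))⁻¹) =O[atTop] fun _ => (1 : ℝ) := by
  refine IsBigO.of_bound 1 ?_
  filter_upwards [eventually_ge_atTop 1] with n hn
  have : 1 ≤ √(n : ℝ) := Real.one_le_sqrt.2 (by exact_mod_cast hn)
  rw [Real.norm_of_nonneg (by positivity), norm_one, mul_one]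
  exact inv_le_one_of_one_le₀ this

theorem inv_isBigO_inv_sqrt :
    (fun n : ℕ => (n : ℝ)⁻¹) =O[atTop] fun n : ℕ => (√(n : ℝ))⁻¹ := by
  have h := inv_sqrt_isBigO_one.mul (isBigO_refl (fun n : ℕ => (√(n : ℝ))⁻¹) atTop)
  refine h.congr (fun n => ?_) fun n => one_mul _
  rw [← mul_inv, Real.mul_self_sqrt (by positivity)]

namespace RootRate

variable {a b : ℕ → ℝ} {d e : ℝ}

theorem isBigO_one (h : RootRate a d) : a =O[atTop] fun _ => (1 : ℝ) := by
  have h1 := (IsBigO.trans h inv_sqrt_isBigO_one).add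
    (isBigO_const_const d (one_ne_zero (α := ℝ)) atTop)
  simpa using h1

theorem const (d : ℝ) : RootRate (fun _ => d) d := by
  simpa [RootRate] using isBigO_zero _ _

theorem mul (ha : RootRate a d) (hb : RootRate b e) : RootRate (fun n => a n * b n) (d * e) := by
  have h1 := IsBigO.mul ha hb.isBigO_one
  have h2 := IsBigO.const_mul_left hb d
  simp only [mul_one] at h1
  exact (h1.add h2).congr_left fun n => by ring

theorem sum {ι : Type*} {s : Finset ι} {a : ι → ℕ → ℝ} {d : ι → ℝ}
    (h : ∀ i ∈ s, RootRate (a i) (d i)) :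
    RootRate (fun n => ∑ i ∈ s, a i n) (∑ i ∈ s, d i) :=
  (IsBigO.sum h).congr_left fun n => by simp [Finset.sum_apply]

theorem of_sub (ha : RootRate a d)
    (h : (fun n => b n - a n) =O[atTop] fun n : ℕ => (√(n : ℝ))⁻¹) : RootRate b d :=
  (IsBigO.add h ha).congr_left fun n => by ring

theorem tendsto (h : RootRate a d) : Tendsto a atTop (𝓝 d) := by
  have h0 : Tendsto (fun n : ℕ => (√(n : ℝ))⁻¹) atTop (𝓝 0) :=
    (Real.tendsto_sqrt_atTop.comp tendsto_natCast_atTop_atTop).inv_tendsto_atTop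
  exact tendsto_sub_nhds_zero_iff.1 (IsBigO.trans_tendsto h h0)

end RootRate

/-- Error bound for square roots, from `y - c = (y ^ 2 - c ^ 2) / (y + c)`. -/
theorem RootRate.of_sq {a : ℕ → ℝ} {c : ℝ} (hc : 0 < c) (ha : ∀ n, 0 ≤ a n)
    (h : RootRate (fun n => a n ^ 2) (c ^ 2)) : RootRate a c := by
  refine IsBigO.trans (IsBigO.of_bound c⁻¹ (Eventually.of_forall fun n => ?_)) h
  have h1 : c ≤ a n + c := by linarith [ha n]
  rw [inv_mul_eq_div, le_div_iff₀ hc, sq_sub_sq, norm_mul,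
    Real.norm_of_nonneg (hc.le.trans h1), mul_comm (‖a n - c‖)]
  gcongr

theorem RootRate.of_abs_sub_le {a : ℕ → ℝ} {d C : ℝ} (h : ∀ n : ℕ, 1 ≤ n → |a n - d| ≤ C / n) :
    RootRate a d := by
  refine IsBigO.trans (IsBigO.of_bound C ?_) inv_isBigO_inv_sqrt
  filter_upwards [eventually_ge_atTop 1] with n hn
  rw [Real.norm_eq_abs, Real.norm_of_nonneg (by positivity), ← div_eq_mul_inv]
  exact h n hn

/-! ### Asymptotics of the moments of the number of rising steps -/

theorem negBinomCoeff_add_one {a : ℝ} (ha : 0 < a) (N : ℕ) :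
    negBinomCoeff (a + 1) N = (a + N) / a * negBinomCoeff a N := by
  induction N with
  | zero => simp [negBinomCoeff_zero, ha.ne']
  | succ N ih =>
    have h' : (N : ℝ) + 1 ≠ 0 := by positivity
    apply mul_left_cancel₀ h'
    rw [negBinomCoeff_succ, ih, mul_left_comm ((N : ℝ) + 1), negBinomCoeff_succ]
    push_cast
    field_simp
    ring

theorem negBinomCoeff_three_halves (N : ℕ) :
    negBinomCoeff (3 / 2) N = 2 / √Real.pi * (Real.Gamma (N + 3 / 2) / Real.Gamma (N + 1)) := by
  induction N with
  | zero =>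
    have h : Real.Gamma (3 / 2) = 1 / 2 * √Real.pi := by
      rw [← Real.Gamma_one_half_eq, ← Real.Gamma_add_one (by norm_num)]
      norm_num
    rw [negBinomCoeff_zero, Nat.cast_zero, zero_add, zero_add, h, Real.Gamma_one]
    have : √Real.pi ≠ 0 := by positivity
    field_simp
  | succ N ih =>
    have h' : (N : ℝ) + 1 ≠ 0 := by positivity
    have h2 : (N : ℝ) + 3 / 2 ≠ 0 := by positivity
    have h3 : Real.Gamma (N + 1) ≠ 0 := (Real.Gamma_pos_of_pos (by positivity)).ne'
    apply mul_left_cancel₀ h'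
    rw [negBinomCoeff_succ, ih, Nat.cast_add, Nat.cast_one,
      show (N : ℝ) + 1 + 3 / 2 = N + 3 / 2 + 1 by ring, Real.Gamma_add_one h2,
      Real.Gamma_add_one h']
    field_simp
    ring

/-- Logarithmic convexity of the Gamma function at a midpoint. -/
theorem Gamma_add_half_sq_le {x : ℝ} (hx : 0 < x) :
    Real.Gamma (x + 1 / 2) ^ 2 ≤ Real.Gamma x * Real.Gamma (x + 1) := by
  have h := Real.Gamma_mul_add_mul_le_rpow_Gamma_mul_rpow_Gamma hx (by linarith : 0 < x + 1)
    (one_half_pos (α := ℝ)) (one_half_pos (α := ℝ)) (by norm_num)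
  have h1 := Real.Gamma_pos_of_pos hx
  have h2 := Real.Gamma_pos_of_pos (by linarith : 0 < x + 1)
  rw [show 1 / 2 * x + 1 / 2 * (x + 1) = x + 1 / 2 by ring, ← Real.sqrt_eq_rpow,
    ← Real.sqrt_eq_rpow, ← Real.sqrt_mul h1.le] at h
  have h3 := Real.Gamma_pos_of_pos (by linarith : 0 < x + 1 / 2)
  calc Real.Gamma (x + 1 / 2) ^ 2 ≤ √(Real.Gamma x * Real.Gamma (x + 1)) ^ 2 := by gcongr
    _ = _ := Real.sq_sqrt (by positivity)

theorem Gamma_ratio_sq_bounds (N : ℕ) :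
    (N : ℝ) + 1 / 2 ≤ (Real.Gamma (N + 3 / 2) / Real.Gamma (N + 1)) ^ 2 ∧
      (Real.Gamma (N + 3 / 2) / Real.Gamma (N + 1)) ^ 2 ≤ N + 1 := by
  have h1 : (0 : ℝ) < N + 1 := by positivity
  have h2 : (0 : ℝ) < N + 1 / 2 := by positivity
  have g1 := Real.Gamma_pos_of_pos h1
  have g2 := Real.Gamma_pos_of_pos h2
  have e1 : Real.Gamma (N + 3 / 2) = (N + 1 / 2) * Real.Gamma (N + 1 / 2) := by
    rw [← Real.Gamma_add_one h2.ne']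
    ring_nf
  have e2 := Real.Gamma_add_one h1.ne'
  have i1 := Gamma_add_half_sq_le h1
  have i2 := Gamma_add_half_sq_le h2
  rw [show (N : ℝ) + 1 + 1 / 2 = N + 3 / 2 by ring, e2] at i1
  rw [show (N : ℝ) + 1 / 2 + 1 / 2 = N + 1 by ring, show (N : ℝ) + 1 / 2 + 1 = N + 3 / 2 by ring,
    e1] at i2
  rw [div_pow]
  constructor
  · rw [le_div_iff₀ (by positivity), e1]
    calc ((N : ℝ) + 1 / 2) * Real.Gamma (N + 1) ^ 2
        ≤ (N + 1 / 2) * (Real.Gamma (N + 1 / 2) * ((N + 1 / 2) * Real.Gamma (N + 1 / 2))) := by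
          gcongr
      _ = _ := by ring
  · rw [div_le_iff₀ (by positivity)]
    linarith

/-- The `k`-th moment of the half-normal law. -/
noncomputable def halfNormalMoment (k : ℕ) : ℝ := Real.Gamma (((k : ℝ) + 1) / 2) / √Real.pi

theorem halfNormalMoment_zero : halfNormalMoment 0 = 1 := by
  have : √Real.pi ≠ 0 := by positivity
  rw [halfNormalMoment, Nat.cast_zero, zero_add, Real.Gamma_one_half_eq, div_self this]

theorem halfNormalMoment_one : halfNormalMoment 1 = 1 / √Real.pi := by
  rw [halfNormalMoment, Nat.cast_one, show ((1 : ℝ) + 1) / 2 = 1 by norm_num, Real.Gamma_one]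

theorem halfNormalMoment_add_two (k : ℕ) :
    halfNormalMoment (k + 2) = ((k : ℝ) + 1) / 2 * halfNormalMoment k := by
  have h : (((k + 2 : ℕ) : ℝ) + 1) / 2 = ((k : ℝ) + 1) / 2 + 1 := by push_cast; ring
  rw [halfNormalMoment, h, Real.Gamma_add_one (by positivity), mul_div_assoc, halfNormalMoment]

theorem rootRate_risingMoment {N : ℕ → ℕ} (h₁ : ∀ n, 4 * N n ≤ n + 3) (h₂ : ∀ n, n ≤ 4 * N n + 1)
    (r : ℕ) :
    RootRate (fun n => r.factorial * negBinomCoeff (1 + r / 2) (N n) / √(n : ℝ) ^ r)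
      (halfNormalMoment r) := by
  have h₁' : ∀ n, (4 : ℝ) * N n ≤ n + 3 := fun n => by exact_mod_cast h₁ n
  have h₂' : ∀ n : ℕ, (n : ℝ) ≤ 4 * N n + 1 := fun n => by exact_mod_cast h₂ n
  induction r using Nat.twoStepInduction with
  | zero =>
    simp only [Nat.cast_zero, zero_div, add_zero, negBinomCoeff_one, pow_zero, Nat.factorial_zero,
      Nat.cast_one, mul_one, div_one, halfNormalMoment_zero]
    exact RootRate.const 1
  | one =>
    rw [halfNormalMoment_one]
    refine RootRate.of_sq (by positivity) (fun n => ?_) (RootRate.of_abs_sub_le (C := 16) ?_)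
    · rw [Nat.cast_one, show (1 : ℝ) + 1 / 2 = 3 / 2 by norm_num, negBinomCoeff_three_halves]
      have := Real.Gamma_pos_of_pos (by positivity : (0 : ℝ) < N n + 3 / 2)
      have := Real.Gamma_pos_of_pos (by positivity : (0 : ℝ) < N n + 1)
      positivity
    · intro n hn
      have hn' : (0 : ℝ) < n := by exact_mod_cast hn
      obtain ⟨b1, b2⟩ := Gamma_ratio_sq_bounds (N n)
      rw [Nat.cast_one, show (1 : ℝ) + 1 / 2 = 3 / 2 by norm_num, negBinomCoeff_three_halves]
      generalize Real.Gamma (N n + 3 / 2) / Real.Gamma (N n + 1) = q at b1 b2 ⊢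
      have e : ((Nat.factorial 1 : ℕ) * (2 / √Real.pi * q) / √(n : ℝ) ^ 1) ^ 2 -
          (1 / √Real.pi) ^ 2 = (4 * q ^ 2 - n) / Real.pi / n := by
        rw [Nat.factorial_one, Nat.cast_one, one_mul, pow_one, div_pow, mul_pow, div_pow, div_pow,
          Real.sq_sqrt Real.pi_nonneg, Real.sq_sqrt hn'.le]
        field_simp
        ring
      rw [e, abs_div, abs_of_pos hn', abs_div, abs_of_pos Real.pi_pos]
      gcongr
      rw [div_le_iff₀ Real.pi_pos]
      have hpi := Real.pi_gt_three
      rw [abs_le]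
      constructor <;> nlinarith [h₁' n, h₂' n]
  | more r ih _ =>
    have hq : RootRate (fun n => 2 * ((r : ℝ) + 1) * ((1 + r / 2 + N n) / n))
        (((r : ℝ) + 1) / 2) := by
      have h : RootRate (fun n => (1 + (r : ℝ) / 2 + N n) / n) (1 / 4) := by
        refine RootRate.of_abs_sub_le (C := 2 + r / 2) fun n hn => ?_
        have hn' : (0 : ℝ) < n := by exact_mod_cast hn
        have e : (1 + (r : ℝ) / 2 + N n) / n - 1 / 4 = (1 + r / 2 + N n - n / 4) / n := by
          field_simp
        rw [e, abs_div, abs_of_pos hn']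
        gcongr
        have hr : (0 : ℝ) ≤ r := Nat.cast_nonneg r
        rw [abs_le]
        constructor <;> linarith [h₁' n, h₂' n]
      convert (RootRate.const (2 * ((r : ℝ) + 1))).mul h using 1
      ring
    rw [halfNormalMoment_add_two]
    convert hq.mul ih using 2 with n
    have e : (1 + ((r + 2 : ℕ) : ℝ) / 2) = 1 + r / 2 + 1 := by push_cast; ring
    have hs : √(n : ℝ) ^ (r + 2) = n * √(n : ℝ) ^ r := by
      rw [pow_add, Real.sq_sqrt (by positivity), mul_comm]
    rw [e, negBinomCoeff_add_one (by positivity), hs, Nat.factorial_succ, Nat.factorial_succ]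
    push_cast
    have : (2 : ℝ) + r ≠ 0 := by positivity
    field_simp
    ring

/-- The number of rising steps in about `n / 2` steps of the walk, divided by `√n`, has
asymptotically half-normal moments. -/
theorem rootRate_upSteps {m : ℕ → ℕ} (h₁ : ∀ n, 2 * m n ≤ n + 1) (h₂ : ∀ n, n ≤ 2 * m n + 1)
    (k : ℕ) :
    RootRate (fun n => coinMean (m n) (fun w => (upSteps 0 w : ℝ) ^ k) / √(n : ℝ) ^ k)
      (halfNormalMoment k) := by
  have hrise : ∀ r : ℕ, RootRate (fun n => coinMean (m n)
      (fun w => ((visits (-1) w + 1).ascFactorial r : ℝ)) / √(n : ℝ) ^ r) (halfNormalMoment r) := by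
    intro r
    simp only [coinMean_ascFactorial_visits]
    exact rootRate_risingMoment (N := fun n => (m n + 1) / 2)
      (fun n => by have := h₁ n; omega) (fun n => by have := h₂ n; omega) r
  cases k with
  | zero => simpa using hrise 0
  | succ k =>
    refine (hrise (k + 1)).of_sub ?_
    have hb := ((hrise k).isBigO_one.mul
      (isBigO_refl (fun n : ℕ => (√(n : ℝ))⁻¹) atTop)).const_mul_left (((k + 1 : ℕ) : ℝ) ^ (k + 2))
    simp only [one_mul] at hb
    refine IsBigO.trans (IsBigO.of_norm_le fun n => ?_) hb
    have h := abs_coinMean_upSteps_sub_le (m n) k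
    rw [← sub_div, norm_div, Real.norm_eq_abs, Real.norm_of_nonneg (by positivity)]
    refine (div_le_div_of_nonneg_right h (by positivity)).trans_eq ?_
    rw [pow_succ (√(n : ℝ)), div_eq_mul_inv, div_eq_mul_inv, mul_inv]
    ring

/-! ### Cuts far from the middle of the deck -/

theorem coinMean_half_pow_count (n : ℕ) (b : Bool) :
    coinMean n (fun w => (1 / 2 : ℝ) ^ w.count b) = (3 / 4) ^ n := by
  have h : coinSum n (fun w => (1 / 2 : ℝ) ^ w.count b) = (3 / 2) ^ n := by
    induction n with
    | zero => simp [coinSum]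
    | succ n ih =>
      cases b <;>
      · simp only [coinSum, List.count_cons_self, List.count_cons_of_ne (by simp : true ≠ false),
          List.count_cons_of_ne (by simp : false ≠ true), pow_succ, coinSum_mul_right, ih]
        ring
  rw [coinMean, h, ← div_pow]
  norm_num

/-- Chernoff bound with the weight `(1 / 2) ^ count`. -/
theorem coinMean_small_count_le (n : ℕ) (b : Bool) :
    coinMean n (fun w => if w.count b ≤ n / 4 + 2 then 1 else 0) ≤ 4 * (9 / 10) ^ n := by
  have h1 : coinMean n (fun w => if w.count b ≤ n / 4 + 2 then 1 else 0) ≤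
      coinMean n fun w => 2 ^ (n / 4 + 2) * (1 / 2 : ℝ) ^ w.count b := by
    refine coinMean_mono fun w _ => ?_
    split_ifs with h
    · rw [one_div, inv_pow, ← div_eq_mul_inv, one_le_div (by positivity)]
      exact pow_le_pow_right₀ (by norm_num) h
    · positivity
  -- `2 ≤ (6 / 5) ^ 4`
  have h2 : (2 : ℝ) ^ (n / 4) ≤ (6 / 5) ^ n :=
    calc (2 : ℝ) ^ (n / 4) ≤ ((6 / 5) ^ 4) ^ (n / 4) := by gcongr; norm_num
      _ = (6 / 5) ^ (4 * (n / 4)) := (pow_mul _ _ _).symm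
      _ ≤ (6 / 5) ^ n := pow_le_pow_right₀ (by norm_num) (Nat.mul_div_le n 4)
  rw [coinMean_mul_left, coinMean_half_pow_count] at h1
  calc _ ≤ _ := h1
    _ = 4 * (2 ^ (n / 4) * (3 / 4) ^ n) := by ring
    _ ≤ 4 * ((6 / 5) ^ n * (3 / 4) ^ n) := by gcongr
    _ = 4 * (9 / 10) ^ n := by rw [← mul_pow]; norm_num

/-- The `s`-th moment of the number of correct guesses. -/
noncomputable def guessMoment (s n : ℕ) : ℝ :=
  coinMean n fun w => (correctGuesses n (deckOf (w.count true) 0 0 w) : ℝ) ^ s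

/-- The `s`-th moment of the sum of the numbers of rising steps of two independent walks, with
`⌈n / 2⌉` and `⌊n / 2⌋` steps. -/
noncomputable def upStepsMoment (s n : ℕ) : ℝ :=
  coinMean ((n + 1) / 2) fun u => coinMean (n / 2) fun v =>
    ((upSteps 0 u : ℝ) + upSteps 0 v) ^ s

theorem abs_guessMoment_sub_le (s n : ℕ) :
    |guessMoment s n - upStepsMoment s n| ≤ (n : ℝ) ^ s * (8 * (9 / 10) ^ n) := by
  have hn : n = (n + 1) / 2 + n / 2 := by omega
  set Y : List Bool → ℝ := fun w =>
    ((upSteps 0 (w.take ((n + 1) / 2)) : ℝ) +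
      upSteps 0 ((w.drop ((n + 1) / 2)).map not).reverse) ^ s with hY
  have h1 : upStepsMoment s n = coinMean n Y := by
    conv_rhs => rw [hn, coinMean_append]
    rw [upStepsMoment, coinMean, coinMean]
    congr 1
    refine coinSum_congr fun u hu => ?_
    rw [← coinMean_reverse_map_not]
    simp only [hY, ← hu, List.take_left, List.drop_left]
  set bad : List Bool → ℝ := fun w => (n : ℝ) ^ s *
    ((if w.count true ≤ n / 4 + 2 then 1 else 0) + if w.count false ≤ n / 4 + 2 then 1 else 0)
    with hbad
  have h2 : coinMean n bad ≤ (n : ℝ) ^ s * (8 * (9 / 10) ^ n) := by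
    rw [hbad, coinMean_mul_left, coinMean_add]
    gcongr
    linarith [coinMean_small_count_le n true, coinMean_small_count_le n false]
  have h3 : ∀ w : List Bool, w.length = n →
      |(correctGuesses n (deckOf (w.count true) 0 0 w) : ℝ) ^ s - Y w| ≤ bad w := by
    intro w hw
    have hl1 : (w.take ((n + 1) / 2)).length = (n + 1) / 2 := by
      rw [List.length_take]
      omega
    have hl2 : (w.drop ((n + 1) / 2)).length = n / 2 := by
      rw [List.length_drop]
      omega
    have hw' := List.take_append_drop ((n + 1) / 2) w
    by_cases hg : n / 4 + 2 < w.count true ∧ n / 4 + 2 < w.count false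
    · have h := correctGuesses_eq_upSteps n _ _ hl1 hl2 (by rw [hw']; exact hg.1)
        (by rw [hw']; exact hg.2)
      rw [hw'] at h
      rw [h, hY, hbad]
      simp only [Nat.cast_add, sub_self, abs_zero]
      positivity
    · have hX0 : (correctGuesses n (deckOf (w.count true) 0 0 w) : ℝ) ^ s ≤ (n : ℝ) ^ s := by
        gcongr
        exact correctGuesses_le _ _
      have hY0 : Y w ≤ (n : ℝ) ^ s := by
        have e1 := upSteps_le_length 0 (w.take ((n + 1) / 2))
        have e2 := upSteps_le_length 0 ((w.drop ((n + 1) / 2)).map not).reverse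
        rw [List.length_reverse, List.length_map] at e2
        rw [hY]
        dsimp only
        gcongr
        exact_mod_cast (by omega : upSteps 0 (w.take ((n + 1) / 2)) +
          upSteps 0 ((w.drop ((n + 1) / 2)).map not).reverse ≤ n)
      have hX1 : (0 : ℝ) ≤ (correctGuesses n (deckOf (w.count true) 0 0 w) : ℝ) ^ s := by positivity
      have hY1 : 0 ≤ Y w := by rw [hY]; positivity
      have hb : (n : ℝ) ^ s ≤ bad w := by
        rw [hbad]
        refine le_mul_of_one_le_right (by positivity) ?_
        rw [not_and_or, not_lt, not_lt] at hg
        rcases hg with hg | hg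
        · rw [if_pos hg]
          split_ifs <;> norm_num
        · rw [if_pos hg]
          split_ifs <;> norm_num
      rw [abs_le]
      constructor <;> linarith
  rw [h1, guessMoment]
  refine le_trans ?_ h2
  rw [abs_le]
  constructor
  · rw [neg_le_sub_iff_le_add, ← coinMean_add]
    exact coinMean_mono fun w hw => by linarith [(abs_le.1 (h3 w hw)).1]
  · rw [sub_le_iff_le_add, ← coinMean_add]
    exact coinMean_mono fun w hw => by linarith [(abs_le.1 (h3 w hw)).2]

theorem limitMoment_eq_sum (s : ℕ) :
    limitMoment s = ∑ k ∈ Finset.range (s + 1),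
      (s.choose k : ℝ) * (halfNormalMoment k * halfNormalMoment (s - k)) := by
  refine Finset.sum_congr rfl fun k hk => ?_
  rw [halfNormalMoment, halfNormalMoment, Nat.cast_sub (Nat.lt_succ_iff.1 (Finset.mem_range.1 hk)),
    div_mul_div_comm, Real.mul_self_sqrt Real.pi_nonneg]

theorem limitMoment_pos (s : ℕ) : 0 < limitMoment s := by
  rw [limitMoment_eq_sum]
  refine Finset.sum_pos (fun k hk => ?_) ⟨0, by simp⟩
  have h : ∀ j : ℕ, 0 < halfNormalMoment j := fun j =>
    div_pos (Real.Gamma_pos_of_pos (by positivity)) (by positivity)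
  have hc : 0 < s.choose k := Nat.choose_pos (Nat.lt_succ_iff.1 (Finset.mem_range.1 hk))
  have := h k
  have := h (s - k)
  positivity

theorem rootRate_upStepsMoment (s : ℕ) :
    RootRate (fun n => upStepsMoment s n / √(n : ℝ) ^ s) (limitMoment s) := by
  have h : ∀ n, upStepsMoment s n / √(n : ℝ) ^ s = ∑ k ∈ Finset.range (s + 1), (s.choose k : ℝ) *
      ((coinMean ((n + 1) / 2) (fun w => (upSteps 0 w : ℝ) ^ k) / √(n : ℝ) ^ k) *
        (coinMean (n / 2) (fun w => (upSteps 0 w : ℝ) ^ (s - k)) / √(n : ℝ) ^ (s - k))) := by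
    intro n
    have e : upStepsMoment s n = ∑ k ∈ Finset.range (s + 1), (s.choose k : ℝ) *
        (coinMean ((n + 1) / 2) (fun w => (upSteps 0 w : ℝ) ^ k) *
          coinMean (n / 2) fun w => (upSteps 0 w : ℝ) ^ (s - k)) := by
      simp only [upStepsMoment, add_pow, coinMean_finset_sum, coinMean_mul_right,
        coinMean_mul_left]
      exact Finset.sum_congr rfl fun k _ => by ring
    rw [e, Finset.sum_div]
    refine Finset.sum_congr rfl fun k hk => ?_
    rw [div_mul_div_comm, ← pow_add,
      Nat.add_sub_cancel' (Nat.lt_succ_iff.1 (Finset.mem_range.1 hk)), mul_div_assoc]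
  simp only [h]
  rw [limitMoment_eq_sum]
  refine RootRate.sum fun k _ => (RootRate.const _).mul (RootRate.mul ?_ ?_)
  · exact rootRate_upSteps (m := fun n => (n + 1) / 2) (fun n => by omega) (fun n => by omega) k
  · exact rootRate_upSteps (m := fun n => n / 2) (fun n => by omega) (fun n => by omega) _

theorem rootRate_guessMoment (s : ℕ) :
    RootRate (fun n => guessMoment s n / √(n : ℝ) ^ s) (limitMoment s) := by
  refine (rootRate_upStepsMoment s).of_sub ?_
  have ht := tendsto_pow_const_mul_const_pow_of_abs_lt_one (s + 1) (r := (9 / 10 : ℝ))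
    (by rw [abs_of_pos] <;> norm_num)
  have hO := (ht.isBigO_one ℝ).mul inv_isBigO_inv_sqrt
  simp only [one_mul] at hO
  refine IsBigO.trans (IsBigO.of_bound 8 ?_) hO
  filter_upwards [eventually_ge_atTop 1] with n hn
  have hn' : (1 : ℝ) ≤ n := by exact_mod_cast hn
  have hs : 1 ≤ √(n : ℝ) ^ s := one_le_pow₀ (Real.one_le_sqrt.2 hn')
  rw [← sub_div, norm_div, Real.norm_of_nonneg (by positivity : 0 ≤ √(n : ℝ) ^ s),
    Real.norm_of_nonneg (by positivity : 0 ≤ (n : ℝ) ^ (s + 1) * (9 / 10) ^ n * (n : ℝ)⁻¹),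
    Real.norm_eq_abs]
  calc _ ≤ |guessMoment s n - upStepsMoment s n| := div_le_self (abs_nonneg _) hs
    _ ≤ _ := abs_guessMoment_sub_le s n
    _ = _ := by
      have : (n : ℝ) ≠ 0 := by positivity
      field_simp
      ring

/-! ### Integrals against the law of the correct guesses and the half-normal law -/

theorem lintegral_correctGuessesLaw (s n : ℕ) :
    ∫⁻ x, ENNReal.ofReal ((x : ℝ) ^ s) ∂(correctGuessesLaw n) =
      ENNReal.ofReal (guessMoment s n) := by
  have h1 : ∀ x : ℕ, ENNReal.ofReal ((x : ℝ) ^ s) = ((x ^ s : ℕ) : ℝ≥0∞) := fun x => by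
    rw [← Nat.cast_pow, ENNReal.ofReal_natCast]
  have h2 : ∫⁻ x, ENNReal.ofReal ((x : ℝ) ^ s) ∂(correctGuessesLaw n) =
      expect ((riffleShuffle n).map (correctGuesses n)) fun x => ((x ^ s : ℕ) : ℝ≥0∞) := by
    rw [lintegral_countable', expect]
    refine tsum_congr fun x => ?_
    rw [h1, correctGuessesLaw, PMF.toMeasure_apply_singleton _ _ (measurableSet_singleton x),
      mul_comm]
  rw [h2, expect_map, expect_riffleShuffle, ← natCast_coinSum, guessMoment, coinMean,
    ENNReal.ofReal_div_of_pos (by positivity), ENNReal.ofReal_pow (by norm_num)]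
  simp only [← Nat.cast_pow]
  rw [← natCast_coinSum, ENNReal.ofReal_natCast, ENNReal.ofReal_ofNat]

theorem guessMoment_nonneg (s n : ℕ) : 0 ≤ guessMoment s n := by
  have h := coinMean_mono (n := n) (f := fun _ => 0)
    (g := fun w => (correctGuesses n (deckOf (w.count true) 0 0 w) : ℝ) ^ s)
    fun w _ => by positivity
  rwa [coinMean, coinSum_zero, zero_div] at h

theorem integrable_pow_correctGuessesLaw (s n : ℕ) :
    Integrable (fun x : ℕ => (x : ℝ) ^ s) (correctGuessesLaw n) := by
  refine ⟨Measurable.of_discrete.aestronglyMeasurable, ?_⟩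
  rw [hasFiniteIntegral_iff_ofReal (ae_of_all _ fun x => by positivity),
    lintegral_correctGuessesLaw]
  exact ENNReal.ofReal_lt_top

theorem integral_pow_correctGuessesLaw (s n : ℕ) :
    ∫ x : ℕ, (x : ℝ) ^ s ∂(correctGuessesLaw n) = guessMoment s n := by
  rw [integral_eq_lintegral_of_nonneg_ae (ae_of_all _ fun x => by positivity)
    Measurable.of_discrete.aestronglyMeasurable, lintegral_correctGuessesLaw,
    ENNReal.toReal_ofReal (guessMoment_nonneg s n)]

theorem measurable_halfNormal_density :
    Measurable fun x : ℝ => if 0 ≤ x then 2 / √Real.pi * Real.exp (-x ^ 2) else 0 :=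
  Measurable.ite measurableSet_Ici (by fun_prop) measurable_const

theorem halfNormal_density_nonneg (x : ℝ) :
    0 ≤ if 0 ≤ x then 2 / √Real.pi * Real.exp (-x ^ 2) else 0 := by
  split_ifs <;> positivity

theorem pow_mul_halfNormal_density (k : ℕ) :
    (fun x : ℝ => (if 0 ≤ x then 2 / √Real.pi * Real.exp (-x ^ 2) else 0) * x ^ k) =
      (Set.Ici (0 : ℝ)).indicator
        fun x => 2 / √Real.pi * (x ^ (k : ℝ) * Real.exp (-x ^ (2 : ℝ))) := by
  ext x
  by_cases hx : 0 ≤ x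
  · rw [Set.indicator_of_mem (Set.mem_Ici.2 hx), if_pos hx]
    norm_cast
    ring
  · rw [Set.indicator_of_notMem (by simpa using hx), if_neg hx, zero_mul]

theorem integrable_pow_halfNormalLaw (k : ℕ) : Integrable (fun x : ℝ => x ^ k) halfNormalLaw := by
  rw [halfNormalLaw, integrable_withDensity_iff
    (measurable_halfNormal_density.ennreal_ofReal) (ae_of_all _ fun x => ENNReal.ofReal_lt_top)]
  simp only [ENNReal.toReal_ofReal (halfNormal_density_nonneg _), mul_comm (_ ^ k : ℝ)]
  rw [pow_mul_halfNormal_density, integrable_indicator_iff measurableSet_Ici,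
    integrableOn_Ici_iff_integrableOn_Ioi]
  refine Integrable.const_mul ?_ _
  exact integrableOn_rpow_mul_exp_neg_rpow (by have : (0 : ℝ) ≤ k := Nat.cast_nonneg k; linarith)
    (by norm_num)

theorem integral_pow_halfNormalLaw (k : ℕ) :
    ∫ x, x ^ k ∂halfNormalLaw = halfNormalMoment k := by
  rw [halfNormalLaw, integral_withDensity_eq_integral_toReal_smul
    (measurable_halfNormal_density.ennreal_ofReal) (ae_of_all _ fun x => ENNReal.ofReal_lt_top)]
  simp only [ENNReal.toReal_ofReal (halfNormal_density_nonneg _), smul_eq_mul]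
  rw [pow_mul_halfNormal_density, integral_indicator measurableSet_Ici,
    integral_Ici_eq_integral_Ioi, integral_const_mul,
    integral_rpow_mul_exp_neg_rpow two_pos
      (by have : (0 : ℝ) ≤ k := Nat.cast_nonneg k; linarith), halfNormalMoment]
  ring

section HalfNormal

variable {Ω : Type*} [MeasurableSpace Ω] {P : Measure Ω} {H H₁ H₂ : Ω → ℝ}

theorem integrable_pow_of_hasLaw_halfNormalLaw (hH : HasLaw H halfNormalLaw P) (k : ℕ) :
    Integrable (fun ω => H ω ^ k) P := by
  have h := integrable_pow_halfNormalLaw k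
  rw [← hH.map_eq] at h
  exact h.comp_aemeasurable hH.aemeasurable

theorem integral_pow_of_hasLaw_halfNormalLaw (hH : HasLaw H halfNormalLaw P) (k : ℕ) :
    ∫ ω, H ω ^ k ∂P = halfNormalMoment k := by
  rw [← integral_pow_halfNormalLaw, ← hH.map_eq,
    integral_map hH.aemeasurable (by fun_prop)]

theorem indepFun_pow_pow (hH : IndepFun H₁ H₂ P) (j k : ℕ) :
    IndepFun (fun ω => H₁ ω ^ j) (fun ω => H₂ ω ^ k) P :=
  hH.comp (measurable_id.pow_const j) (measurable_id.pow_const k)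

theorem integrable_mul_choose (hH₁ : HasLaw H₁ halfNormalLaw P) (hH₂ : HasLaw H₂ halfNormalLaw P)
    (hH : IndepFun H₁ H₂ P) (s k : ℕ) :
    Integrable (fun ω => H₁ ω ^ k * H₂ ω ^ (s - k) * (s.choose k : ℝ)) P :=
  ((indepFun_pow_pow hH k (s - k)).integrable_mul (integrable_pow_of_hasLaw_halfNormalLaw hH₁ k)
    (integrable_pow_of_hasLaw_halfNormalLaw hH₂ (s - k))).mul_const _

theorem integrable_add_pow (hH₁ : HasLaw H₁ halfNormalLaw P) (hH₂ : HasLaw H₂ halfNormalLaw P)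
    (hH : IndepFun H₁ H₂ P) (s : ℕ) : Integrable (fun ω => (H₁ ω + H₂ ω) ^ s) P := by
  simp only [add_pow]
  exact integrable_finsetSum _ fun k _ => integrable_mul_choose hH₁ hH₂ hH s k

theorem integral_add_pow (hH₁ : HasLaw H₁ halfNormalLaw P) (hH₂ : HasLaw H₂ halfNormalLaw P)
    (hH : IndepFun H₁ H₂ P) (s : ℕ) : ∫ ω, (H₁ ω + H₂ ω) ^ s ∂P = limitMoment s := by
  simp only [add_pow]
  rw [integral_finsetSum _ fun k _ => integrable_mul_choose hH₁ hH₂ hH s k, limitMoment_eq_sum]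
  refine Finset.sum_congr rfl fun k _ => ?_
  rw [integral_mul_const, (indepFun_pow_pow hH k (s - k)).integral_fun_mul_eq_mul_integral
      (integrable_pow_of_hasLaw_halfNormalLaw hH₁ k).aestronglyMeasurable
      (integrable_pow_of_hasLaw_halfNormalLaw hH₂ (s - k)).aestronglyMeasurable,
    integral_pow_of_hasLaw_halfNormalLaw hH₁, integral_pow_of_hasLaw_halfNormalLaw hH₂, mul_comm]

end HalfNormal

end RiffleGuessing

theorem theorem2
    {Ω : ℕ → Type*} [∀ n, MeasurableSpace (Ω n)] (P : ∀ n, Measure (Ω n))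
    [∀ n, IsProbabilityMeasure (P n)]
    (X : ∀ n, Ω n → ℕ) (hX : ∀ n, HasLaw (X n) (RiffleGuessing.correctGuessesLaw n) (P n))
    {Ω' : Type*} [MeasurableSpace Ω'] (P' : Measure Ω') [IsProbabilityMeasure P']
    (H₁ H₂ : Ω' → ℝ)
    (hH₁ : HasLaw H₁ RiffleGuessing.halfNormalLaw P')
    (hH₂ : HasLaw H₂ RiffleGuessing.halfNormalLaw P')
    (hH : IndepFun H₁ H₂ P')
    (s : ℕ) :
    (∀ n, Integrable (fun ω => (X n ω : ℝ) ^ s) (P n)) ∧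
    Integrable (fun ω => (H₁ ω + H₂ ω) ^ s) P' ∧
    ∫ ω, (H₁ ω + H₂ ω) ^ s ∂P' = RiffleGuessing.limitMoment s ∧
    Tendsto (fun n : ℕ => ∫ ω, ((X n ω : ℝ) / √(n : ℝ)) ^ s ∂(P n)) atTop
      (𝓝 (∫ ω, (H₁ ω + H₂ ω) ^ s ∂P')) ∧
    ∃ ε : ℕ → ℝ,
      ε =O[atTop] (fun n : ℕ => (n : ℝ) ^ (-(1 / 2) : ℝ)) ∧
      ∀ n : ℕ, 1 ≤ n →
        ∫ ω, (X n ω : ℝ) ^ s ∂(P n) =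
          RiffleGuessing.limitMoment s * (n : ℝ) ^ ((s : ℝ) / 2) * (1 + ε n) := by
  have hint : ∀ n, Integrable (fun ω => (X n ω : ℝ) ^ s) (P n) := by
    intro n
    have h := RiffleGuessing.integrable_pow_correctGuessesLaw s n
    rw [← (hX n).map_eq] at h
    exact h.comp_aemeasurable (hX n).aemeasurable
  have hmom : ∀ n, ∫ ω, (X n ω : ℝ) ^ s ∂(P n) = RiffleGuessing.guessMoment s n := by
    intro n
    rw [← RiffleGuessing.integral_pow_correctGuessesLaw, ← (hX n).map_eq,
      integral_map (hX n).aemeasurable Measurable.of_discrete.aestronglyMeasurable]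
  have hlim := RiffleGuessing.integral_add_pow hH₁ hH₂ hH s
  have hrate := RiffleGuessing.rootRate_guessMoment s
  have hpos := RiffleGuessing.limitMoment_pos s
  refine ⟨hint, RiffleGuessing.integrable_add_pow hH₁ hH₂ hH s, hlim, ?_,
    fun n => RiffleGuessing.guessMoment s n / √(n : ℝ) ^ s / RiffleGuessing.limitMoment s - 1,
    ?_, ?_⟩
  · rw [hlim]
    simp only [div_pow, integral_div, hmom]
    exact hrate.tendsto
  · have h := hrate.const_mul_left (RiffleGuessing.limitMoment s)⁻¹
    refine h.congr (fun n => ?_) fun n => ?_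
    · field_simp
    · rw [Real.rpow_neg (Nat.cast_nonneg n), Real.sqrt_eq_rpow]
  · intro n hn
    have hn' : (0 : ℝ) < n := by exact_mod_cast hn
    have hs : (n : ℝ) ^ ((s : ℝ) / 2) = √(n : ℝ) ^ s := by
      rw [Real.sqrt_eq_rpow, ← Real.rpow_natCast, ← Real.rpow_mul hn'.le]
      ring_nf
    have hs' : √(n : ℝ) ^ s ≠ 0 := by positivity
    rw [hmom, hs, add_sub_cancel]
    field_simp
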